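/- Let $X$ and $Y$ be Polish spaces with their Borel $\sigma$-algebras $\mathcal B(X)$ and $\mathcal B(Y)$, let $\phi\colon X\to Y$ be Borel measurable, and let $\mu$ and $\nu$ be measures on $\mathcal B(X)$ and $\mathcal B(Y)$. Let $\{\mu_y : y\in Y\}$ be a $\sigma$-finite disintegration of $\mu$ with respect to $(\nu,\phi)$; that is, each $\mu_y$ is a $\sigma$-finite measure on $\mathcal B(X)$, and - for every $B\in\mathcal B(X)$ the map $y\mapsto\mu_y(B)$ is Borel measurable, - $\mu_y(X\setminus\phi^{-1}(y))=0$ for every $y\in Y$, - $\mu(B)=\int_Y\mu_y(B)\,d\nu(y)$ for every $B\in\mathcal B(X)$. Let $\mathcal K(X)$ be the space of compact subsets of $X$ with the Vietoris topology. Consider the following statements. 1. $\{\mu_y\}$ is uniformly $\sigma$-finite: there is a sequence $(B_n)$ in $\mathcal B(X)$ such that $\mu_y(B_n)<\infty$ for all $n$ and all $y\in Y$, and $\mu_y\left(X\setminus\bigcup_n B_n\right)=0$ for all $y\in Y$. 2. There is a sequence of Borel maps $y\mapsto K_n(y)$ from $Y$ into $\mathcal K(X)$ such that $\mu_y(K_n(y))<\infty$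 for all $y$ and $n$, and $\mu_y\left(X\setminus\bigcup_n K_n(y)\right)=0$ for all $y$. 3. The map $(y,K)\mapsto\mu_y(K)$ from $Y\times\mathcal K(X)$ to $[0,\infty]$ is Borel measurable. Then (1) and (2) are equivalent, and each of them implies (3). Moreover, if every $\mu_y$ is purely atomic (every Borel set of positive $\mu_y$-measure contains an atom of $\mu_y$, that is, a Borel set of positive $\mu_y$-measure that is not the union of two disjoint Borel sets of positive $\mu_y$-measure), then (1), (2) and (3) are equivalent. -/

import Mathlib

open MeasureTheory TopologicalSpace
open scoped ENNReal

/-- The space of compact subsets of `X` (the empty set included), with its Vietoris topology,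
carries the Borel σ-algebra of that topology. -/
instance compactsMeasurableSpace (X : Type*) [TopologicalSpace X] :
    MeasurableSpace (Compacts X) :=
  borel (Compacts X)

instance compactsBorelSpace (X : Type*) [TopologicalSpace X] : BorelSpace (Compacts X) :=
  ⟨rfl⟩

/-- The family `κ y` of measures on `X` is a disintegration of `μ` with respect to `(ν, φ)`. -/
structure IsDisintegration {X Y : Type*} [MeasurableSpace X] [MeasurableSpace Y]
    (κ : Y → Measure X) (μ : Measure X) (ν : Measure Y) (φ : X → Y) : Prop where
  measurable_apply : ∀ B : Set X, MeasurableSet B → Measurable fun y => κ y B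
  fiber : ∀ y : Y, κ y (φ ⁻¹' {y})ᶜ = 0
  apply_eq_lintegral : ∀ B : Set X, MeasurableSet B → μ B = ∫⁻ y, κ y B ∂ν

/-- A disintegration all of whose members are σ-finite measures. -/
structure IsSigmaFiniteDisintegration {X Y : Type*} [MeasurableSpace X] [MeasurableSpace Y]
    (κ : Y → Measure X) (μ : Measure X) (ν : Measure Y) (φ : X → Y) : Prop
    extends IsDisintegration κ μ ν φ where
  sigmaFinite : ∀ y : Y, SigmaFinite (κ y)

/-- A single sequence of measurable sets witnesses the σ-finiteness of all `κ y` at once. -/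
def UniformlySigmaFinite {X Y : Type*} [MeasurableSpace X] (κ : Y → Measure X) : Prop :=
  ∃ B : ℕ → Set X, (∀ n, MeasurableSet (B n)) ∧
    (∀ n y, κ y (B n) < ∞) ∧ ∀ y, κ y (⋃ n, B n)ᶜ = 0

/-- There are Borel maps `K n` from `Y` to the compact subsets of `X` such that, for every `y`,
the sets `K n y` have finite `κ y`-measure and together carry `κ y`. -/
def HasBorelCompactExhaustion {X Y : Type*} [TopologicalSpace X] [MeasurableSpace X]
    [MeasurableSpace Y] (κ : Y → Measure X) : Prop :=
  ∃ K : ℕ → Y → Compacts X, (∀ n, Measurable (K n)) ∧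
    (∀ y n, κ y (K n y : Set X) < ∞) ∧ ∀ y, κ y (⋃ n, (K n y : Set X))ᶜ = 0

/-- The map `(y, K) ↦ κ y K` from `Y × Compacts X` to `[0, ∞]` is Borel measurable. -/
def JointlyBorelOnCompacts {X Y : Type*} [TopologicalSpace X] [MeasurableSpace X]
    [TopologicalSpace Y] (κ : Y → Measure X) : Prop :=
  Measurable[borel (Y × Compacts X)] fun p : Y × Compacts X => κ p.1 (p.2 : Set X)

/-- `A` is an atom of `m`: it has positive measure, and it cannot be split into two measurable
parts of positive measure. -/
def IsMeasureAtom {X : Type*} [MeasurableSpace X] (m : Measure X) (A : Set X) : Prop :=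
  MeasurableSet A ∧ 0 < m A ∧ ∀ B ⊆ A, MeasurableSet B → m B = 0 ∨ m (A \ B) = 0

/-- Every measurable set of positive measure contains an atom. The zero measure qualifies. -/
def IsPurelyAtomicMeasure {X : Type*} [MeasurableSpace X] (m : Measure X) : Prop :=
  ∀ E : Set X, MeasurableSet E → 0 < m E → ∃ A ⊆ E, IsMeasureAtom m A

/-! Uniform σ-finiteness gives compact exhaustions because Ulam's tightness argument can be run
measurably in `y`: the numbers of balls needed are chosen as least witnesses, and the resulting
compact set depends upper semicontinuously on that sequence of numbers. Refining the topology of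
each `B n` to a Polish one keeps the compact sets inside `B n`. Conversely, `{x | x ∈ K n (φ x)}` is
Borel and agrees with `K n y` on the fibre over `y`, which carries `κ y`. Uniform σ-finiteness gives
joint measurability by writing `κ` as a countable sum of finite kernels, since membership `x ∈ K` is
a closed relation. In the purely atomic case, joint measurability on singletons makes the set of
points `x` with `κ (φ x) {x} > 0` Borel. It carries every `κ y` and has countable fibres, so the
Lusin–Novikov theorem cuts it into countably many Borel sets on which `φ` is injective. Each meets a
fibre in at most one point, of finite mass. -/

/-- A map into the hyperspace of compact sets is Borel as soon as it is upper semi-measurable. -/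
theorem measurable_compacts_of_subset_isOpen {X Y : Type*} [TopologicalSpace X]
    [PseudoMetrizableSpace X] [SecondCountableTopology X] [MeasurableSpace Y] {f : Y → Compacts X}
    (hf : ∀ U : Set X, IsOpen U → MeasurableSet {y | (f y : Set X) ⊆ U}) : Measurable f := by
  let _ := pseudoMetrizableSpacePseudoMetric X
  have hit : ∀ U : Set X, IsOpen U → MeasurableSet {y | ((f y : Set X) ∩ U).Nonempty} := by
    intro U hU
    -- An open set is a countable union of closed sets, and missing a closed set means lying in its
    -- open complement.
    obtain ⟨F, hF, -, hFU, -⟩ := hU.exists_iUnion_isClosed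
    have : {y | ((f y : Set X) ∩ U).Nonempty} = ⋃ n, {y | (f y : Set X) ⊆ (F n)ᶜ}ᶜ := by
      ext y
      simp only [← hFU, Set.mem_ofPred_eq, Set.mem_iUnion, Set.mem_compl_iff, Set.Nonempty,
        Set.mem_inter_iff, Set.not_subset, not_not]
      grind
    rw [this]
    exact .iUnion fun n => (hf _ (hF n).isOpen_compl).compl
  obtain ⟨b, hbc, -, hb⟩ := exists_countable_basis X
  have hc := hb.compacts
  rw [BorelSpace.measurable_eq (α := Compacts X), hc.borel_eq_generateFrom]
  refine measurable_generateFrom ?_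
  rintro _ ⟨u, ⟨hu, hub⟩, rfl⟩
  have : f ⁻¹' {K : Compacts X | ↑K ⊆ ⋃₀ u ∧ ∀ U ∈ u, (↑K ∩ U).Nonempty} =
      {y | (f y : Set X) ⊆ ⋃₀ u} ∩ ⋂ U ∈ u, {y | ((f y : Set X) ∩ U).Nonempty} := by
    ext y
    simp
  rw [this]
  exact (hf _ (isOpen_sUnion fun U hU => hb.isOpen (hub hU))).inter
    (.biInter hu.countable fun U hU => hit U (hb.isOpen (hub hU)))

/-! ### Measurable tightness of finite measures -/

section BallCover

variable {X : Type*} [MetricSpace X] [SecondCountableTopology X] [Nonempty X]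

/-- The union of the closed balls of radius `1 / (j + 1)` around the first `n + 1` points of a
dense sequence. -/
def ballCover (X : Type*) [MetricSpace X] [SecondCountableTopology X] [Nonempty X]
    (j n : ℕ) : Set X :=
  ⋃ i ∈ Set.Iic n, Metric.closedBall (denseSeq X i) (1 / ((j : ℝ) + 1))

theorem isClosed_ballCover (j n : ℕ) : IsClosed (ballCover X j n) :=
  (Set.finite_Iic n).isClosed_biUnion fun _ _ => Metric.isClosed_closedBall

theorem ballCover_mono (j : ℕ) : Monotone (ballCover X j) := fun _ _ h =>
  Set.biUnion_subset_biUnion_left (Set.Iic_subset_Iic.2 h)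

theorem iUnion_ballCover (j : ℕ) : ⋃ n, ballCover X j n = Set.univ := by
  refine Set.eq_univ_of_forall fun x => ?_
  obtain ⟨i, hi⟩ := (denseRange_denseSeq X).exists_dist_lt x
    (show (0 : ℝ) < 1 / ((j : ℝ) + 1) by positivity)
  exact Set.mem_iUnion.2 ⟨i, Set.mem_biUnion (Set.mem_Iic.2 le_rfl) (Metric.mem_closedBall.2 hi.le)⟩

variable [CompleteSpace X]

/-- An ultrafilter containing a finite union of balls contains one of them; hence it is Cauchy. -/
theorem exists_mem_iInter_ballCover_of_ultrafilter (s : ℕ → ℕ) (u : Ultrafilter X)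
    (hu : ∀ j, ballCover X j (s j) ∈ u) :
    ∃ x ∈ ⋂ j, ballCover X j (s j), (u : Filter X) ≤ nhds x := by
  have hc : Cauchy (u : Filter X) := by
    refine Metric.cauchy_iff.2 ⟨inferInstance, fun ε hε => ?_⟩
    obtain ⟨j, hj⟩ := exists_nat_one_div_lt (half_pos hε)
    obtain ⟨i, -, hi⟩ := (Ultrafilter.finite_biUnion_mem_iff (Set.finite_Iic (s j))).1 (hu j)
    refine ⟨_, hi, fun x hx y hy => ?_⟩
    have := dist_triangle_right x y (denseSeq X i)
    rw [Metric.mem_closedBall] at hx hy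
    linarith
  obtain ⟨x, hx⟩ := CompleteSpace.complete hc
  exact ⟨x, Set.mem_iInter.2 fun j => (isClosed_ballCover j _).mem_of_frequently_of_tendsto
    (Filter.Eventually.frequently (hu j)) hx, hx⟩

/-- The compact set of points that lie in `ballCover X j (s j)` for all `j`. -/
def ballCoverCompact (X : Type*) [MetricSpace X] [SecondCountableTopology X] [Nonempty X]
    [CompleteSpace X] (s : ℕ → ℕ) : Compacts X where
  carrier := ⋂ j, ballCover X j (s j)
  isCompact' := isCompact_iff_ultrafilter_le_nhds.2 fun u hu =>
    exists_mem_iInter_ballCover_of_ultrafilter s u fun j =>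
      Filter.mem_of_superset (Filter.le_principal_iff.1 hu) (Set.iInter_subset _ j)

/-- By compactness, finitely many coordinates of `s` already force the inclusion in `U`: otherwise
an ultrafilter on the partial intersections outside `U` would converge to a point of the compact set
outside `U`. -/
theorem isOpen_ballCoverCompact_subset {U : Set X} (hU : IsOpen U) :
    IsOpen {s | (ballCoverCompact X s : Set X) ⊆ U} := by
  refine isOpen_iff_forall_mem_open.2 fun s hs => ?_
  obtain ⟨J, hJ⟩ : ∃ J, ⋂ j ∈ Set.Iio J, ballCover X j (s j) ⊆ U := by
    by_contra! h
    have hne : (⨅ J : ℕ, Filter.principal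
        ((⋂ j ∈ Set.Iio J, ballCover X j (s j)) ∩ Uᶜ)).NeBot := by
      refine Filter.iInf_neBot_of_directed ?_ fun J => ?_
      · refine Antitone.directed_ge fun J J' hJ => Filter.principal_mono.2 ?_
        exact Set.inter_subset_inter_left _
          (Set.biInter_subset_biInter_left (Set.Iio_subset_Iio hJ))
      · rw [Filter.principal_neBot_iff]
        obtain ⟨x, hx, hxU⟩ := Set.not_subset.1 (h J)
        exact ⟨x, hx, hxU⟩
    set u := Ultrafilter.of (⨅ J : ℕ, Filter.principal
        ((⋂ j ∈ Set.Iio J, ballCover X j (s j)) ∩ Uᶜ))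
    have hu : ∀ J : ℕ, (⋂ j ∈ Set.Iio J, ballCover X j (s j)) ∩ Uᶜ ∈ (u : Filter X) := fun J =>
      Ultrafilter.of_le _ (Filter.mem_iInf_of_mem J (Filter.mem_principal_self _))
    obtain ⟨x, hx, hux⟩ := exists_mem_iInter_ballCover_of_ultrafilter s u fun j =>
      Filter.mem_of_superset (hu (j + 1)) (Set.inter_subset_left.trans
        (Set.biInter_subset_of_mem (Set.mem_Iio.2 (Nat.lt_succ_self j))))
    exact hU.isClosed_compl.mem_of_frequently_of_tendsto
      (Filter.Eventually.frequently (Filter.mem_of_superset (hu 0) Set.inter_subset_right)) hux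
      (hs hx)
  refine ⟨PiNat.cylinder s J, fun t ht => ?_, PiNat.isOpen_cylinder _ _ _,
    PiNat.self_mem_cylinder _ _⟩
  refine Set.Subset.trans (fun x hx => Set.mem_iInter₂.2 fun j hj => ?_) hJ
  rw [← ht j hj]
  exact Set.mem_iInter.1 hx j

theorem measurable_ballCoverCompact : Measurable (ballCoverCompact X) :=
  measurable_compacts_of_subset_isOpen fun _ hU =>
    (isOpen_ballCoverCompact_subset hU).measurableSet

end BallCover

/-- A measurable family of finite measures on a Polish space is tight in a measurable way. -/
theorem exists_measurable_compacts_of_finite {X Y : Type*} [TopologicalSpace X] [PolishSpace X]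
    [MeasurableSpace X] [BorelSpace X] [MeasurableSpace Y] (m : Y → Measure X)
    (hm : Measurable m) (hfin : ∀ y, IsFiniteMeasure (m y)) :
    ∃ K : ℕ → Y → Compacts X, (∀ n, Measurable (K n)) ∧
      ∀ y, m y (⋃ n, (K n y : Set X))ᶜ = 0 := by
  classical
  let _ := upgradeIsCompletelyMetrizable X
  rcases isEmpty_or_nonempty X with _ | _
  · exact ⟨fun _ _ => ⊥, fun _ => measurable_const, fun y => by
      rw [Set.eq_empty_of_isEmpty (_ᶜ), measure_empty]⟩
  -- The error budget: the `k`-th compact set will miss mass at most `1 / (k + 1)`.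
  have hex : ∀ k : ℕ, ∃ δ : ℕ → NNReal, (∀ j, 0 < δ j) ∧
      ∑' j, (δ j : ℝ≥0∞) < ((k : ℝ≥0∞) + 1)⁻¹ := fun k =>
    ENNReal.exists_pos_sum_of_countable (by simp) ℕ
  choose δ hδ hδs using hex
  have hN : ∀ k j y, ∃ n, m y (ballCover X j n)ᶜ < δ k j := by
    intro k j y
    have h : Filter.Tendsto (fun n => m y (ballCover X j n)ᶜ) Filter.atTop
        (nhds (m y (⋂ n, (ballCover X j n)ᶜ))) :=
      tendsto_measure_iInter_atTop
        (fun n => (isClosed_ballCover j n).measurableSet.compl.nullMeasurableSet)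
        (fun _ _ h => Set.compl_subset_compl.2 (ballCover_mono j h)) ⟨0, measure_ne_top _ _⟩
    rw [← Set.compl_iUnion, iUnion_ballCover, Set.compl_univ, measure_empty] at h
    exact (h.eventually_lt_const (by exact_mod_cast hδ k j)).exists
  have hmeas : ∀ k j, Measurable fun y => Nat.find (hN k j y) := fun k j =>
    measurable_find (hN k j) fun n => measurableSet_lt
      ((Measure.measurable_coe (isClosed_ballCover j n).measurableSet.compl).comp hm)
      measurable_const
  refine ⟨fun k y => ballCoverCompact X fun j => Nat.find (hN k j y), fun k =>
    measurable_ballCoverCompact.comp (measurable_pi_lambda _ fun j => hmeas k j), fun y => ?_⟩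
  have hle : ∀ k : ℕ, m y (⋃ n, (ballCoverCompact X fun j => Nat.find (hN n j y) : Set X))ᶜ ≤
      ((k : ℝ≥0∞) + 1)⁻¹ := fun k =>
    calc m y (⋃ n, (ballCoverCompact X fun j => Nat.find (hN n j y) : Set X))ᶜ
        ≤ m y (⋃ j, (ballCover X j (Nat.find (hN k j y)))ᶜ) := by
          refine measure_mono ?_
          rw [← Set.compl_iInter]
          exact Set.compl_subset_compl.2 (Set.subset_iUnion
            (fun n => (ballCoverCompact X fun j => Nat.find (hN n j y) : Set X)) k)
      _ ≤ ∑' j, m y (ballCover X j (Nat.find (hN k j y)))ᶜ := measure_iUnion_le _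
      _ ≤ ∑' j, (δ k j : ℝ≥0∞) := ENNReal.tsum_le_tsum fun j => (Nat.find_spec (hN k j y)).le
      _ ≤ _ := (hδs k).le
  refine le_antisymm (ge_of_tendsto' (x := Filter.atTop)
    (f := fun k : ℕ => ((k : ℝ≥0∞) + 1)⁻¹) ?_ hle) zero_le
  have := (Filter.tendsto_add_atTop_iff_nat 1).2 ENNReal.tendsto_inv_nat_nhds_zero
  simpa using this

/-! ### The Lusin–Novikov theorem -/

section LusinNovikov

variable {Z Y : Type*} [MeasurableSpace Z] {φ : Z → Y}

/-- `s` is covered by countably many measurable sets on each of which `φ` is injective. -/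
def IsCountablyInjOn (φ : Z → Y) (s : Set Z) : Prop :=
  ∃ B : ℕ → Set Z, (∀ n, MeasurableSet (B n)) ∧ (∀ n, Set.InjOn φ (B n)) ∧ s ⊆ ⋃ n, B n

theorem IsCountablyInjOn.mono {s t : Set Z} (ht : IsCountablyInjOn φ t) (h : s ⊆ t) :
    IsCountablyInjOn φ s :=
  let ⟨B, hB, hi, hc⟩ := ht
  ⟨B, hB, hi, h.trans hc⟩

theorem IsCountablyInjOn.of_injOn {s : Set Z} (hs : MeasurableSet s) (h : Set.InjOn φ s) :
    IsCountablyInjOn φ s :=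
  ⟨fun _ => s, fun _ => hs, fun _ => h, Set.subset_iUnion (fun _ : ℕ => s) 0⟩

theorem IsCountablyInjOn.empty : IsCountablyInjOn φ (∅ : Set Z) :=
  .of_injOn .empty (Set.injOn_empty φ)

theorem IsCountablyInjOn.iUnion {ι : Type*} [Countable ι] {s : ι → Set Z}
    (h : ∀ i, IsCountablyInjOn φ (s i)) : IsCountablyInjOn φ (⋃ i, s i) := by
  rcases isEmpty_or_nonempty ι with _ | _
  · simpa using IsCountablyInjOn.empty
  choose B hB hi hc using h
  obtain ⟨e, he⟩ := exists_surjective_nat (ι × ℕ)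
  refine ⟨fun n => B (e n).1 (e n).2, fun n => hB _ _, fun n => hi _ _, ?_⟩
  refine Set.iUnion_subset fun i x hx => ?_
  obtain ⟨n, hn⟩ := Set.mem_iUnion.1 (hc i hx)
  obtain ⟨m, hm⟩ := he (i, n)
  exact Set.mem_iUnion.2 ⟨m, by rwa [hm]⟩

theorem IsCountablyInjOn.union {s t : Set Z} (hs : IsCountablyInjOn φ s)
    (ht : IsCountablyInjOn φ t) : IsCountablyInjOn φ (s ∪ t) := by
  rw [Set.union_eq_iUnion]
  exact .iUnion fun b => by cases b <;> assumption

variable [MeasurableSpace Y]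

/-- The family `A l`, indexed by the binary words `l` of length `n`, is small: `Y` is covered by
measurable sets `C l` such that the part of `A l` above `C l` is countably injective. -/
def IsSmallFamily (φ : Z → Y) (n : ℕ) (A : List Bool → Set Z) : Prop :=
  ∃ C : List Bool → Set Y, (∀ l, MeasurableSet (C l)) ∧ (∀ y, ∃ l, l.length = n ∧ y ∈ C l) ∧
    ∀ l, l.length = n → IsCountablyInjOn φ (A l ∩ φ ⁻¹' C l)

/-- The family that refines `A` by splitting `A l` along the pair of sets `p (k l)`. -/
def splitFamily {ι : Type*} (p : ι → Set Z × Set Z) (A : List Bool → Set Z)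
    (k : List Bool → ι) : List Bool → Set Z
  | [] => ∅
  | b :: l => A l ∩ bif b then (p (k l)).1 else (p (k l)).2

/-- The complements of `D` and `D'` cover `Y`, and nothing of `A l` or `A l'` lies above them. The
case `l = l'` is allowed and serves to exclude empty members. -/
theorem isSmallFamily_of_disjoint {n : ℕ} {A : List Bool → Set Z} {l l' : List Bool}
    (hl : l.length = n) (hl' : l'.length = n) {D D' : Set Y} (hD : MeasurableSet D)
    (hD' : MeasurableSet D') (hDD' : Disjoint D D') (hA : A l ⊆ φ ⁻¹' D)
    (hA' : A l' ⊆ φ ⁻¹' D') : IsSmallFamily φ n A := by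
  classical
  refine ⟨fun x => (if x = l then Dᶜ else ∅) ∪ (if x = l' then D'ᶜ else ∅), fun x => ?_,
    fun y => ?_, fun x hx => IsCountablyInjOn.empty.mono ?_⟩
  · exact .union (by split_ifs; exacts [hD.compl, .empty])
      (by split_ifs; exacts [hD'.compl, .empty])
  · by_cases hy : y ∈ D
    · exact ⟨l', hl', Or.inr (by simpa using hDD'.notMem_of_mem_left hy)⟩
    · exact ⟨l, hl, Or.inl (by simpa using hy)⟩
  · rintro z ⟨hz, hz' | hz'⟩
    · split_ifs at hz' with h
      · exact hz' (hA (h ▸ hz))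
      · exact hz'
    · split_ifs at hz' with h
      · exact hz' (hA' (h ▸ hz))
      · exact hz'

/-- Suppose every choice `k` gives a small family; only its values on words of length `n` are
varied, so countably many choices suffice. If `y` is in no `C' l`, each `l` has an index that fails
for `y`, and the choice made of these indices contradicts its own cover. Above `C' l`, remove the
countably injective pieces `P k`: if two points of one fibre remained, some pair `p i` would
separate them, and a choice with value `i` at `l` would have removed one of them. -/
theorem exists_not_isSmallFamily_splitFamily {ι : Type*} [Countable ι] [Nonempty ι]
    (hφ : Measurable φ) {p : ι → Set Z × Set Z}
    (hp : ∀ i, MeasurableSet (p i).1 ∧ MeasurableSet (p i).2)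
    (hsep : ∀ x x', x ≠ x' → ∃ i, x ∈ (p i).1 ∧ x' ∈ (p i).2) {n : ℕ} {A : List Bool → Set Z}
    (hA : ∀ l, MeasurableSet (A l)) (h : ¬ IsSmallFamily φ n A) :
    ∃ k : List Bool → ι, ¬ IsSmallFamily φ (n + 1) (splitFamily p A k) := by
  by_contra! hk
  choose C hCm hCc hCI using hk
  have : Finite {l : List Bool | l.length = n} := List.finite_length_eq Bool n
  let e : ({l : List Bool | l.length = n} → ι) → List Bool → ι :=
    fun k => Function.extend Subtype.val k fun _ => Classical.arbitrary ι
  let C' : List Bool → Set Y := fun l =>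
    ⋂ m, ⋃ k, ⋃ _ : e k l = m, C (e k) (true :: l) ∪ C (e k) (false :: l)
  have hC'm : ∀ l, MeasurableSet (C' l) := fun l =>
    .iInter fun m => .iUnion fun k => .iUnion fun _ => (hCm _ _).union (hCm _ _)
  refine h ⟨C', hC'm, fun y => ?_, fun l hl => ?_⟩
  · by_contra! hy
    have hm : ∀ l : {l : List Bool | l.length = n}, ∃ m, ∀ k, e k l = m →
        y ∉ C (e k) (true :: l) ∪ C (e k) (false :: l) := by
      intro l
      have := hy l l.2
      simp only [C', Set.mem_iInter, Set.mem_iUnion, not_forall] at this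
      obtain ⟨m, hm⟩ := this
      exact ⟨m, fun k hk hyk => hm ⟨k, hk, hyk⟩⟩
    choose m hm using hm
    obtain ⟨l, hl, hyl⟩ := hCc (e m) y
    rcases l with _ | ⟨b, l⟩
    · simp at hl
    · have hl' : l.length = n := by simpa using hl
      have := hm ⟨l, hl'⟩ m (Subtype.val_injective.extend_apply m _ ⟨l, hl'⟩)
      cases b
      · exact this (Or.inr hyl)
      · exact this (Or.inl hyl)
  · let P : ({l : List Bool | l.length = n} → ι) → Set Z := fun k =>
      (p (e k l)).1 ∩ φ ⁻¹' C (e k) (true :: l) ∪ (p (e k l)).2 ∩ φ ⁻¹' C (e k) (false :: l)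
    have hPm : ∀ k, MeasurableSet (P k) := fun k =>
      ((hp _).1.inter (hφ (hCm _ _))).union ((hp _).2.inter (hφ (hCm _ _)))
    have hP : IsCountablyInjOn φ (⋃ k, A l ∩ P k) := by
      refine .iUnion fun k => ((hCI (e k) (true :: l) (by simpa using hl)).union
        (hCI (e k) (false :: l) (by simpa using hl))).mono ?_
      rintro z ⟨hz, hz' | hz'⟩
      · exact Or.inl ⟨⟨hz, hz'.1⟩, hz'.2⟩
      · exact Or.inr ⟨⟨hz, hz'.1⟩, hz'.2⟩
    have hR : IsCountablyInjOn φ ((A l ∩ φ ⁻¹' C' l) \ ⋃ k, P k) := by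
      refine .of_injOn (((hA l).inter (hφ (hC'm l))).diff (.iUnion hPm)) ?_
      rintro x ⟨⟨-, hxC⟩, hxP⟩ x' ⟨-, hxP'⟩ hxx'
      by_contra hne
      obtain ⟨i, hi, hi'⟩ := hsep x x' hne
      obtain ⟨k, hk, hyk⟩ : ∃ k, e k l = i ∧
          φ x ∈ C (e k) (true :: l) ∪ C (e k) (false :: l) := by
        simpa [C'] using Set.mem_iInter.1 hxC i
      rcases hyk with hyk | hyk
      · exact hxP (Set.mem_iUnion.2 ⟨k, Or.inl ⟨hk ▸ hi, hyk⟩⟩)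
      · exact hxP' (Set.mem_iUnion.2 ⟨k, Or.inr ⟨hk ▸ hi', by
          rw [Set.mem_preimage, ← hxx']; exact hyk⟩⟩)
    refine (hP.union hR).mono fun z hz => ?_
    by_cases hzP : z ∈ ⋃ k, P k
    · obtain ⟨k, hk⟩ := Set.mem_iUnion.1 hzP
      exact Or.inl (Set.mem_iUnion.2 ⟨k, hz.1, hk⟩)
    · exact Or.inr ⟨hz, hzP⟩

end LusinNovikov

theorem exists_closed_separating_pairs (Z : Type*) [MetricSpace Z] [SecondCountableTopology Z]
    [Nonempty Z] {ε : ℝ≥0∞} (hε : 0 < ε) :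
    ∃ p : ℕ × ℕ × ℕ → Set Z × Set Z, (∀ i, IsClosed (p i).1 ∧ IsClosed (p i).2) ∧
      (∀ i, Disjoint (p i).1 (p i).2) ∧
      (∀ i, Metric.ediam (p i).1 ≤ ε ∧ Metric.ediam (p i).2 ≤ ε) ∧
      ∀ x x', x ≠ x' → ∃ i, x ∈ (p i).1 ∧ x' ∈ (p i).2 := by
  classical
  let B : ℕ → ℕ → Set Z := fun i r => Metric.closedBall (denseSeq Z i) (1 / ((r : ℝ) + 1))
  let good : ℕ × ℕ × ℕ → Prop := fun i => Disjoint (B i.1 i.2.2) (B i.2.1 i.2.2) ∧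
    Metric.ediam (B i.1 i.2.2) ≤ ε ∧ Metric.ediam (B i.2.1 i.2.2) ≤ ε
  refine ⟨fun i => if good i then (B i.1 i.2.2, B i.2.1 i.2.2) else (∅, ∅), fun i => ?_,
    fun i => ?_, fun i => ?_, fun x x' hne => ?_⟩
  · dsimp only
    split_ifs
    exacts [⟨Metric.isClosed_closedBall, Metric.isClosed_closedBall⟩,
      ⟨isClosed_empty, isClosed_empty⟩]
  · dsimp only
    split_ifs with h
    exacts [h.1, disjoint_bot_left]
  · dsimp only
    split_ifs with h
    exacts [h.2, by simp]
  obtain ⟨δ, hδ0, hδ⟩ : ∃ δ : ℝ, 0 < δ ∧ ENNReal.ofReal (2 * δ) ≤ ε := by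
    rcases eq_or_ne ε ∞ with rfl | htop
    · exact ⟨1, one_pos, le_top⟩
    · have := ENNReal.toReal_pos hε.ne' htop
      exact ⟨ε.toReal / 2, by positivity, by
        rw [mul_div_cancel₀ _ two_ne_zero, ENNReal.ofReal_toReal htop]⟩
  have hd : 0 < dist x x' := dist_pos.2 hne
  -- The path from `x` to `x'` through both centres and a common point of the balls has four legs,
  -- hence the quarter.
  obtain ⟨r, hr⟩ := exists_nat_one_div_lt (lt_min hδ0 (show 0 < dist x x' / 4 by positivity))
  have hr0 : (0 : ℝ) < 1 / ((r : ℝ) + 1) := by positivity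
  obtain ⟨i, hi⟩ := (denseRange_denseSeq Z).exists_dist_lt x hr0
  obtain ⟨j, hj⟩ := (denseRange_denseSeq Z).exists_dist_lt x' hr0
  have hdiam : ∀ i, Metric.ediam (B i r) ≤ ε := fun i => by
    refine (Metric.ediam_le fun y hy z hz => ?_).trans hδ
    rw [edist_dist]
    refine ENNReal.ofReal_le_ofReal ?_
    have := dist_triangle_right y z (denseSeq Z i)
    have := Metric.mem_closedBall.1 hy
    have := Metric.mem_closedBall.1 hz
    have := hr.trans_le (min_le_left _ _)
    linarith
  have hgood : good (i, j, r) := by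
    refine ⟨Set.disjoint_left.2 fun z hz hz' => ?_, hdiam i, hdiam j⟩
    have h1 := Metric.mem_closedBall.1 hz
    have h2 := Metric.mem_closedBall.1 hz'
    have := dist_triangle x (denseSeq Z i) x'
    have := dist_triangle (denseSeq Z i) z x'
    have := dist_triangle z (denseSeq Z j) x'
    have := hr.trans_le (min_le_right _ _)
    rw [dist_comm] at h1 hj
    linarith
  refine ⟨(i, j, r), ?_⟩
  simp only [if_pos hgood]
  exact ⟨Metric.mem_closedBall.2 hi.le, Metric.mem_closedBall.2 hj.le⟩

/-- If the whole space is not countably injective, repeated splitting yields a Cantor scheme of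
closed sets with no small level. Were `φ` to take two values on the limit set, disjoint
neighbourhoods of them would make some level small. So `φ` is constant on a Cantor set, against
countability of fibres. -/
theorem isCountablyInjOn_univ_of_continuous {Z Y : Type*} [TopologicalSpace Z] [PolishSpace Z]
    [MeasurableSpace Z] [BorelSpace Z] [TopologicalSpace Y] [T2Space Y] [MeasurableSpace Y]
    [BorelSpace Y] {φ : Z → Y} (hφ : Continuous φ)
    (hc : ∀ y, (φ ⁻¹' {y}).Countable) : IsCountablyInjOn φ Set.univ := by
  let _ := upgradeIsCompletelyMetrizable Z
  rcases isEmpty_or_nonempty Z with _ | _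
  · exact IsCountablyInjOn.empty.mono (Set.eq_empty_of_isEmpty _).subset
  by_contra hI
  -- At `n = 0` the bound is `∞`, so the first splitting has no diameter constraint.
  have hε : ∀ n : ℕ, 0 < ((n : ℝ≥0∞))⁻¹ := by simp
  choose p hpc hpd hpe hps using fun n : ℕ => exists_closed_separating_pairs Z (hε n)
  have hcl : ∀ n (A : List Bool → Set Z) k, (∀ l, IsClosed (A l)) →
      ∀ l, IsClosed (splitFamily (p n) A k l) := by
    intro n A k hA l
    rcases l with _ | ⟨b, l⟩
    · exact isClosed_empty
    · cases b
      · exact (hA l).inter (hpc n _).2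
      · exact (hA l).inter (hpc n _).1
  let St : ℕ → Type _ := fun n =>
    {A : List Bool → Set Z // (∀ l, IsClosed (A l)) ∧ ¬ IsSmallFamily φ n A}
  have hstep : ∀ n (A : St n), ∃ k, ¬ IsSmallFamily φ (n + 1) (splitFamily (p n) A.1 k) :=
    fun n A => exists_not_isSmallFamily_splitFamily hφ.measurable
      (fun i => ⟨(hpc n i).1.measurableSet, (hpc n i).2.measurableSet⟩) (hps n)
      (fun l => (A.2.1 l).measurableSet) A.2.2
  choose k hk using hstep
  have h0 : ¬ IsSmallFamily φ 0 fun _ => (Set.univ : Set Z) := by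
    rintro ⟨C, -, hC, hCI⟩
    refine hI ((hCI [] rfl).mono fun z _ => ⟨trivial, ?_⟩)
    obtain ⟨l, hl, hz⟩ := hC (φ z)
    rwa [List.length_eq_zero_iff.1 hl] at hz
  let A : ∀ n, St n := fun n => Nat.rec ⟨fun _ => Set.univ, fun _ => isClosed_univ, h0⟩
    (fun n A => ⟨splitFamily (p n) A.1 (k n A), hcl n _ _ A.2.1, hk n A⟩) n
  let S : List Bool → Set Z := fun l => (A l.length).1 l
  have hSA : ∀ l n, l.length = n → S l = (A n).1 l := by
    rintro l _ rfl
    rfl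
  have hS : ∀ b l, S (b :: l) = S l ∩ bif b then (p l.length (k _ (A l.length) l)).1
      else (p l.length (k _ (A l.length) l)).2 := fun b l => rfl
  have hSne : ∀ l, (S l).Nonempty := by
    intro l
    by_contra hl
    exact (A l.length).2.2 (isSmallFamily_of_disjoint rfl rfl .empty .univ disjoint_bot_left
      (l := l) (l' := l) (by rw [show (A l.length).1 l = ∅ from Set.not_nonempty_iff_eq_empty.1 hl]
                             exact Set.empty_subset _) (Set.subset_univ _))
  have hSanti : CantorScheme.Antitone S := fun l b => by
    rw [hS]
    exact Set.inter_subset_left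
  have hSclosed : ∀ l, IsClosed (S l) := fun l => (A l.length).2.1 l
  have hSdisj : CantorScheme.Disjoint S := by
    intro l a b hab
    have h := hpd l.length (k _ (A l.length) l)
    simp only [hS]
    cases a <;> cases b
    · exact absurd rfl hab
    · exact h.symm.mono Set.inter_subset_right Set.inter_subset_right
    · exact h.mono Set.inter_subset_right Set.inter_subset_right
    · exact absurd rfl hab
  have hSdiam : CantorScheme.VanishingDiam S := by
    intro x
    rw [← Filter.tendsto_add_atTop_iff_nat 1]
    refine tendsto_of_tendsto_of_tendsto_of_le_of_le tendsto_const_nhds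
      ENNReal.tendsto_inv_nat_nhds_zero (fun _ => zero_le) fun n => ?_
    change Metric.ediam (S (PiNat.res x (n + 1))) ≤ _
    rw [PiNat.res_succ, hS]
    refine (Metric.ediam_mono Set.inter_subset_right).trans ?_
    have := hpe (PiNat.res x n).length (k _ (A (PiNat.res x n).length) (PiNat.res x n))
    rw [PiNat.res_length] at this
    rw [PiNat.res_length]
    cases x n
    · exact this.2
    · exact this.1
  have hdom := (hSanti.closureAntitone hSclosed).map_of_vanishingDiam hSdiam hSne
  let f : (ℕ → Bool) → Z := fun x => (CantorScheme.inducedMap S).2 ⟨x, hdom ▸ Set.mem_univ x⟩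
  have hf : Function.Injective f := fun x x' h => by
    simpa using hSdisj.map_injective h
  have hfm : ∀ x n, f x ∈ S (PiNat.res x n) := fun x n => CantorScheme.map_mem _ n
  have hnear : ∀ x (D : Set Y), IsOpen D → φ (f x) ∈ D →
      ∃ n, ∀ m ≥ n, S (PiNat.res x m) ⊆ φ ⁻¹' D := by
    intro x D hD hx
    obtain ⟨ε, hε0, hball⟩ := Metric.isOpen_iff.1 (hD.preimage hφ) _ hx
    obtain ⟨n, hn⟩ := hSdiam.dist_lt ε hε0 x
    have hanti : Antitone fun m => S (PiNat.res x m) :=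
      antitone_nat_of_succ_le fun m => by rw [PiNat.res_succ]; exact hSanti _ _
    exact ⟨n, fun m hm z hz => hball (hn z (hanti hm hz) _ (hfm x n))⟩
  have hconst : ∀ x x', φ (f x) = φ (f x') := by
    intro x x'
    by_contra hne
    obtain ⟨D, D', hD, hD', hxD, hxD', hdis⟩ := t2_separation hne
    obtain ⟨n, hn⟩ := hnear x D hD hxD
    obtain ⟨n', hn'⟩ := hnear x' D' hD' hxD'
    have h1 := hn (max n n') (le_max_left _ _)
    have h2 := hn' (max n n') (le_max_right _ _)
    rw [hSA _ _ (PiNat.res_length _ _)] at h1 h2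
    exact (A (max n n')).2.2 (isSmallFamily_of_disjoint (PiNat.res_length _ _)
      (PiNat.res_length _ _) hD.measurableSet hD'.measurableSet hdis h1 h2)
  have hunc : (Set.univ : Set (ℕ → Bool)).Countable :=
    ((hc (φ (f fun _ => true))).preimage hf).mono fun x _ => hconst x _
  have hle := Cardinal.mk_le_aleph0_iff.2 (Set.countable_univ_iff.1 hunc)
  exact Cardinal.aleph0_lt_continuum.not_ge (by simpa using hle)

theorem Measurable.exists_polishSpace_continuous {Z Y : Type*} [MeasurableSpace Z]
    [StandardBorelSpace Z] [TopologicalSpace Y] [SecondCountableTopology Y] [MeasurableSpace Y]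
    [OpensMeasurableSpace Y] {φ : Z → Y} (hφ : Measurable φ) :
    ∃ _ : TopologicalSpace Z, PolishSpace Z ∧ BorelSpace Z ∧ Continuous φ := by
  obtain ⟨τ, hb, hp⟩ := StandardBorelSpace.polish (α := Z)
  have hZ := BorelSpace.measurable_eq (α := Z)
  obtain ⟨t', ht', hcont, hpol⟩ := hφ.exists_continuous
  exact ⟨t', hpol, ⟨hZ.trans (borel_eq_borel_of_le hpol hp ht').symm⟩, hcont⟩

/-- The Lusin–Novikov theorem: a countable-to-one measurable map between standard Borel spaces is
injective on each of countably many measurable sets that cover its domain. -/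
theorem isCountablyInjOn_univ_of_measurable {Z Y : Type*} [MeasurableSpace Z]
    [StandardBorelSpace Z] [MeasurableSpace Y] [StandardBorelSpace Y] {φ : Z → Y}
    (hφ : Measurable φ) (hc : ∀ y, (φ ⁻¹' {y}).Countable) : IsCountablyInjOn φ Set.univ := by
  obtain ⟨_, _, _⟩ := StandardBorelSpace.polish (α := Y)
  obtain ⟨_, _, _, hcont⟩ := hφ.exists_polishSpace_continuous
  exact isCountablyInjOn_univ_of_continuous hcont hc

/-! ### The membership relation and atoms -/

theorem isClosed_setOfPred_mem_compacts (X : Type*) [TopologicalSpace X] [T2Space X] :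
    IsClosed {p : X × Compacts X | p.1 ∈ p.2} := by
  have h := (Compacts.isOpen_setOfPred_disjoint_coe (α := X)).isClosed_compl.preimage
    ((Compacts.continuous_singleton (α := X)).prodMap continuous_id)
  convert h using 1
  ext ⟨x, K⟩
  simp

/-- Every atom contains a point of positive mass. -/
theorem IsMeasureAtom.exists_singleton_pos {X : Type*} [TopologicalSpace X] [T1Space X]
    [SecondCountableTopology X] [MeasurableSpace X] [OpensMeasurableSpace X] {m : Measure X}
    {A : Set X} (hA : IsMeasureAtom m A) : ∃ x ∈ A, 0 < m {x} := by
  obtain ⟨hAm, hpos, hsplit⟩ := hA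
  obtain ⟨b, hbc, -, hb⟩ := exists_countable_basis X
  -- Each basic open set is null or conull in `A`. Discarding the null ones leaves a point `x`; all
  -- its basic neighbourhoods are conull, and they shrink to `x`, so `{x}` carries the mass of `A`.
  have hdich : ∀ U ∈ b, m (A ∩ U) = 0 ∨ m (A \ U) = 0 := fun U hU => by
    simpa using hsplit (A ∩ U) Set.inter_subset_left (hAm.inter (hb.isOpen hU).measurableSet)
  have hN : m (⋃ U ∈ {U ∈ b | m (A ∩ U) = 0}, A ∩ U) = 0 :=
    (measure_biUnion_null_iff (hbc.mono (Set.sep_subset _ _))).2 fun U hU => hU.2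
  obtain ⟨x, hxA, hx⟩ : ∃ x ∈ A, x ∉ ⋃ U ∈ {U ∈ b | m (A ∩ U) = 0}, A ∩ U := by
    by_contra! h
    exact hpos.ne' (measure_mono_null h hN)
  refine ⟨x, hxA, pos_iff_ne_zero.2 fun hx0 => hpos.ne' ?_⟩
  have hM : m (⋃ U ∈ {U ∈ b | m (A \ U) = 0}, A \ U) = 0 :=
    (measure_biUnion_null_iff (hbc.mono (Set.sep_subset _ _))).2 fun U hU => hU.2
  refine measure_mono_null (fun z hz => ?_) (measure_union_null hx0 hM)
  by_cases hzx : z = x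
  · exact Or.inl hzx
  obtain ⟨U, hU, hxU, hUz⟩ := hb.exists_subset_of_mem_open
    (show x ∈ ({z}ᶜ : Set X) from Ne.symm hzx) isOpen_compl_singleton
  refine Or.inr (Set.mem_biUnion (x := U) ⟨hU, (hdich U hU).resolve_left fun h0 => ?_⟩
    ⟨hz, fun hzU => hUz hzU rfl⟩)
  exact hx (Set.mem_biUnion (x := U) ⟨hU, h0⟩ ⟨hxA, hxU⟩)

/-! ### The implications between the three properties -/

section Disintegration

variable {X Y : Type*} [MeasurableSpace X] {κ : Y → Measure X}

theorem IsDisintegration.measure_inter_fiber [MeasurableSpace Y] {μ : Measure X} {ν : Measure Y}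
    {φ : X → Y} (hκ : IsDisintegration κ μ ν φ) (y : Y) (s : Set X) :
    κ y (s ∩ φ ⁻¹' {y}) = κ y s :=
  measure_inter_conull (hκ.fiber y)

theorem IsDisintegration.measurable [MeasurableSpace Y] {μ : Measure X} {ν : Measure Y}
    {φ : X → Y} (hκ : IsDisintegration κ μ ν φ) : Measurable κ :=
  Measure.measurable_of_measurable_coe _ hκ.measurable_apply

theorem UniformlySigmaFinite.of_countable {ι : Type*} [Countable ι] {B : ι → Set X}
    (hB : ∀ i, MeasurableSet (B i)) (hfin : ∀ i y, κ y (B i) < ∞)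
    (hc : ∀ y, κ y (⋃ i, B i)ᶜ = 0) : UniformlySigmaFinite κ := by
  rcases isEmpty_or_nonempty ι with _ | _
  · exact ⟨fun _ => ∅, fun _ => .empty, by simp, by simpa using hc⟩
  · obtain ⟨e, he⟩ := exists_surjective_nat ι
    exact ⟨B ∘ e, fun n => hB _, fun n => hfin _, fun y => by
      simpa [he.iUnion_comp] using hc y⟩

variable [TopologicalSpace X] [PolishSpace X] [BorelSpace X]

/-- Tightness is applied on `Z` under a Polish topology making `i` continuous; images of compact
sets then stay compact and inside the range. -/
theorem exists_measurable_compacts_of_measurableEmbedding [MeasurableSpace Y] {Z : Type*}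
    [MeasurableSpace Z] [StandardBorelSpace Z] (hκ : Measurable κ) {i : Z → X}
    (hi : MeasurableEmbedding i) (hfin : ∀ y, κ y (Set.range i) < ∞) :
    ∃ K : ℕ → Y → Compacts X, (∀ k, Measurable (K k)) ∧
      (∀ k y, (K k y : Set X) ⊆ Set.range i) ∧
      ∀ y, κ y (Set.range i \ ⋃ k, (K k y : Set X)) = 0 := by
  obtain ⟨_, _, _, hcont⟩ := hi.measurable.exists_polishSpace_continuous
  have hm : Measurable fun y => (κ y).comap i :=
    Measure.measurable_of_measurable_coe _ fun s hs => by
      simp_rw [hi.comap_apply]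
      exact (Measure.measurable_coe (hi.measurableSet_image.2 hs)).comp hκ
  obtain ⟨K, hK, hKc⟩ := exists_measurable_compacts_of_finite _ hm fun y => ⟨by
    rw [hi.comap_apply, Set.image_univ]
    exact hfin y⟩
  refine ⟨fun k y => (K k y).map i hcont, fun k => hcont.compacts_map.measurable.comp (hK k),
    fun k y => Set.image_subset_range _ _, fun y => ?_⟩
  have h := hKc y
  rw [hi.comap_apply, Set.image_compl_eq_range_sdiff_image hi.injective, Set.image_iUnion] at h
  simpa using h

theorem UniformlySigmaFinite.hasBorelCompactExhaustion [MeasurableSpace Y] (hκ : Measurable κ)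
    (h : UniformlySigmaFinite κ) : HasBorelCompactExhaustion κ := by
  obtain ⟨B, hB, hfin, hc⟩ := h
  have key : ∀ n, ∃ K : ℕ → Y → Compacts X, (∀ k, Measurable (K k)) ∧
      (∀ k y, (K k y : Set X) ⊆ B n) ∧ ∀ y, κ y (B n \ ⋃ k, (K k y : Set X)) = 0 := by
    intro n
    have : StandardBorelSpace (B n) := (hB n).standardBorel
    have hr : Set.range (Subtype.val : B n → X) = B n := Subtype.range_coe
    obtain ⟨K, hK, hKB, hKc⟩ := exists_measurable_compacts_of_measurableEmbedding hκ
      (MeasurableEmbedding.subtype_coe (hB n)) fun y => by rw [hr]; exact hfin n y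
    rw [hr] at hKB hKc
    exact ⟨K, hK, hKB, hKc⟩
  choose K hK hKB hKc using key
  refine ⟨fun n => K n.unpair.1 n.unpair.2, fun n => hK _ _, fun y n =>
    (measure_mono (hKB _ _ y)).trans_lt (hfin _ y), fun y => ?_⟩
  refine measure_mono_null (t := (⋃ n, B n)ᶜ ∪ ⋃ n, B n \ ⋃ k, (K n k y : Set X)) (fun x hx => ?_)
    (measure_union_null (hc y) (measure_iUnion_null fun n => hKc n y))
  by_cases hxB : x ∈ ⋃ n, B n
  · obtain ⟨n, hn⟩ := Set.mem_iUnion.1 hxB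
    refine Or.inr (Set.mem_iUnion.2 ⟨n, hn, fun hxK => hx ?_⟩)
    obtain ⟨k, hk⟩ := Set.mem_iUnion.1 hxK
    exact Set.mem_iUnion.2 ⟨Nat.pair n k, by simpa using hk⟩
  · exact Or.inl hxB

theorem HasBorelCompactExhaustion.uniformlySigmaFinite [MeasurableSpace Y] {μ : Measure X}
    {ν : Measure Y} {φ : X → Y} (hφ : Measurable φ) (hκ : IsDisintegration κ μ ν φ)
    (h : HasBorelCompactExhaustion κ) : UniformlySigmaFinite κ := by
  obtain ⟨K, hK, hfin, hc⟩ := h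
  have hfib : ∀ n y, {x | x ∈ K n (φ x)} ∩ φ ⁻¹' {y} = (K n y : Set X) ∩ φ ⁻¹' {y} := by
    rintro n y
    ext x
    simp only [Set.mem_inter_iff, Set.mem_preimage, Set.mem_singleton_iff, and_congr_left_iff]
    rintro rfl
    rfl
  refine ⟨fun n => {x | x ∈ K n (φ x)}, fun n => ?_, fun n y => ?_, fun y => ?_⟩
  · exact (isClosed_setOfPred_mem_compacts X).measurableSet.preimage
      (measurable_id.prodMk ((hK n).comp hφ))
  · rw [← hκ.measure_inter_fiber, hfib, hκ.measure_inter_fiber]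
    exact hfin y n
  · rw [← hκ.measure_inter_fiber, ← hc y, ← hκ.measure_inter_fiber y (⋃ n, (K n y : Set X))ᶜ]
    congr 1
    ext x
    simp only [Set.mem_inter_iff, Set.mem_preimage, Set.mem_singleton_iff, and_congr_left_iff]
    rintro rfl
    simp

variable [TopologicalSpace Y] [MeasurableSpace Y] [BorelSpace Y]

theorem UniformlySigmaFinite.jointlyBorelOnCompacts (hκ : Measurable κ)
    (h : UniformlySigmaFinite κ) : JointlyBorelOnCompacts κ := by
  obtain ⟨B, hB, hfin, hc⟩ := h
  rw [JointlyBorelOnCompacts, ← BorelSpace.measurable_eq (α := Y × Compacts X)]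
  have hD : ∀ n, MeasurableSet (disjointed B n) := fun n => .disjointed hB n
  have heq : ∀ p : Y × Compacts X, κ p.1 (p.2 : Set X) =
      ∑' n, (κ p.1).restrict (disjointed B n) (p.2 : Set X) := by
    intro p
    have hm : MeasurableSet (p.2 : Set X) := p.2.isCompact.measurableSet
    rw [← measure_inter_conull (t := ⋃ n, B n) (by simpa using hc p.1), ← iUnion_disjointed,
      Set.inter_iUnion, measure_iUnion
        (fun i j hij => (disjoint_disjointed B hij).mono Set.inter_subset_right
          Set.inter_subset_right) fun n => hm.inter (hD n)]
    simp_rw [Measure.restrict_apply hm]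
  simp_rw [heq]
  refine Measurable.tsum fun n => ?_
  let η : ProbabilityTheory.Kernel (Y × Compacts X) X :=
    ⟨fun p => (κ p.1).restrict (disjointed B n),
      Measure.measurable_of_measurable_coe _ fun s hs => by
        simp_rw [Measure.restrict_apply hs]
        exact (Measure.measurable_coe (hs.inter (hD n))).comp (hκ.comp measurable_fst)⟩
  have hη : ∀ p, IsFiniteMeasure (η p) := fun p => ⟨by
    change (κ p.1).restrict (disjointed B n) Set.univ < ∞
    rw [Measure.restrict_apply_univ]
    exact (measure_mono (disjointed_subset B n)).trans_lt (hfin n _)⟩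
  have ht : MeasurableSet {q : (Y × Compacts X) × X | q.2 ∈ q.1.2} :=
    (isClosed_setOfPred_mem_compacts X).measurableSet.preimage
      (measurable_snd.prodMk (measurable_snd.comp measurable_fst))
  exact ProbabilityTheory.Kernel.measurable_kernel_prodMk_left_of_finite ht hη

theorem JointlyBorelOnCompacts.uniformlySigmaFinite [StandardBorelSpace Y] {μ : Measure X}
    {ν : Measure Y} {φ : X → Y} (hφ : Measurable φ) (hκ : IsSigmaFiniteDisintegration κ μ ν φ)
    (hat : ∀ y, IsPurelyAtomicMeasure (κ y)) (h : JointlyBorelOnCompacts κ) :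
    UniformlySigmaFinite κ := by
  have := hκ.sigmaFinite
  rw [JointlyBorelOnCompacts, ← BorelSpace.measurable_eq (α := Y × Compacts X)] at h
  let A : Set X := {x | 0 < κ (φ x) {x}}
  have hA : MeasurableSet A := by
    have hw : Measurable fun x => κ (φ x) (({x} : Compacts X) : Set X) :=
      h.comp (hφ.prodMk (Compacts.continuous_singleton (α := X)).measurable)
    simp only [Compacts.coe_singleton] at hw
    exact measurableSet_lt measurable_const hw
  have hmass : ∀ y x, 0 < κ y {x} → φ x = y := fun y x hx => by
    by_contra hne
    exact hx.ne' (measure_mono_null (Set.singleton_subset_iff.2 hne) (hκ.fiber y))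
  have hAc : ∀ y, κ y Aᶜ = 0 := fun y => by
    by_contra h0
    obtain ⟨E, hEA, hE⟩ := hat y Aᶜ hA.compl (pos_iff_ne_zero.2 h0)
    obtain ⟨x, hxE, hx⟩ := hE.exists_singleton_pos
    refine hEA hxE ?_
    change 0 < κ (φ x) {x}
    rwa [hmass y x hx]
  have hcount : ∀ y, ((fun x : A => φ x) ⁻¹' {y}).Countable := fun y => by
    -- A σ-finite measure has only countably many points of positive mass.
    have hc : {x | 0 < κ y {x}}.Countable :=
      Measure.countable_meas_pos_of_disjoint_iUnion (fun x => measurableSet_singleton x)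
        fun x x' hne => Set.disjoint_singleton.2 hne
    refine (hc.preimage Subtype.val_injective).mono fun x hx => ?_
    rw [Set.mem_preimage, Set.mem_singleton_iff] at hx
    exact hx ▸ x.2
  have : StandardBorelSpace A := hA.standardBorel
  obtain ⟨B, hB, hinj, hcov⟩ :=
    isCountablyInjOn_univ_of_measurable (hφ.comp measurable_subtype_coe) hcount
  refine .of_countable (B := fun n => Subtype.val '' B n) (fun n => hA.subtype_image (hB n))
    (fun n y => ?_) fun y => ?_
  · rw [← hκ.toIsDisintegration.measure_inter_fiber]
    have hss : (Subtype.val '' B n ∩ φ ⁻¹' {y}).Subsingleton := by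
      rintro _ ⟨⟨x, hx, rfl⟩, hxy⟩ _ ⟨⟨x', hx', rfl⟩, hxy'⟩
      exact congrArg _ (hinj n hx hx' (Eq.trans hxy (Eq.symm hxy')))
    rcases hss.eq_empty_or_singleton with he | ⟨x, hx⟩
    · simp [he]
    · rw [hx]
      exact measure_singleton_lt_top
  · rw [← Set.image_iUnion, Set.univ_subset_iff.1 hcov, Set.image_univ, Subtype.range_coe]
    exact hAc y

end Disintegration

theorem mainTheorem4 {X Y : Type*}
    [TopologicalSpace X] [PolishSpace X] [MeasurableSpace X] [BorelSpace X]
    [TopologicalSpace Y] [PolishSpace Y] [MeasurableSpace Y] [BorelSpace Y]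
    (φ : X → Y) (hφ : Measurable φ) (μ : Measure X) (ν : Measure Y)
    (κ : Y → Measure X) (hκ : IsSigmaFiniteDisintegration κ μ ν φ) :
    (UniformlySigmaFinite κ ↔ HasBorelCompactExhaustion κ) ∧
    (UniformlySigmaFinite κ → JointlyBorelOnCompacts κ) ∧
    (HasBorelCompactExhaustion κ → JointlyBorelOnCompacts κ) ∧
    ((∀ y, IsPurelyAtomicMeasure (κ y)) →
      [UniformlySigmaFinite κ, HasBorelCompactExhaustion κ, JointlyBorelOnCompacts κ].TFAE) := by
  have hm := hκ.toIsDisintegration.measurable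
  have h12 : UniformlySigmaFinite κ → HasBorelCompactExhaustion κ := fun h =>
    h.hasBorelCompactExhaustion hm
  have h21 : HasBorelCompactExhaustion κ → UniformlySigmaFinite κ := fun h =>
    h.uniformlySigmaFinite hφ hκ.toIsDisintegration
  have h13 : UniformlySigmaFinite κ → JointlyBorelOnCompacts κ := fun h =>
    h.jointlyBorelOnCompacts hm
  refine ⟨⟨h12, h21⟩, h13, h13 ∘ h21, fun hat => ?_⟩
  tfae_have 1 ↔ 2 := ⟨h12, h21⟩
  tfae_have 1 → 3 := h13
  tfae_have 3 → 1 := fun h => h.uniformlySigmaFinite hφ hκ hat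
  tfae_finish
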